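/- Let $A,B:\mathbb{R}\to\mathcal{L}(\mathbb{R}^d)$ be continuous functions with values in the real $d\times d$ matrices, and let $U(t,s)$, $s\le t$, be the evolution operator of $A$, that is, $\frac{\partial}{\partial t}U(t,s)=A(t)U(t,s)$ for $t\ge s$ and $U(s,s)=I$. Let $Z=(Z(t))_{t\in\mathbb{R}}$ be an $\mathbb{R}^d$-valued Lévy process indexed by $\mathbb{R}$: $(Z(t))_{t\ge 0}$ is a Lévy process (it has $Z(0)=0$ a.s., independent and stationary increments, is stochastically continuous, and has càdlàg paths a.s.), $(Z(t))_{t<0}$ is independent of $(Z(t))_{t\ge0}$ and has the same law, as a process, as $(-Z((-t)-))_{t<0}$, and $Z$ has càdlàg paths on $\mathbb{R}$ a.s. Then there is a unique function $\eta:\mathbb{R}^d\to\mathbb{C}$, the exponent of $Z$, such that $\mathbb{E}\,e^{i\langle a,Z(u)\rangle}=e^{-u\eta(a)}$ for all $u\ge 0$ and $a\in\mathbb{R}^d$. Moreover, for all real $s\le t$ the stochastic integral $$Y(t)=\int_s^t U(t,r)B(r)\,dZ(r)$$ exists, and for every $a\in\mathbb{R}^d$ the function $r\mapsto\eta(B(r)^TU(t,r)^Ta)$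 is integrable on $[s,t]$ and $$\mathbb{E}\,e^{i\langle a,Y(t)\rangle}=\exp\left[-\int_s^t\eta\big(B(r)^TU(t,r)^Ta\big)\,dr\right].$$ Here the stochastic integral of a matrix-valued step function $\sum_{i<n}G_i1_{(r_i,r_{i+1}]}$ with $s=r_0\le\dots\le r_n=t$ is $\sum_{i<n}G_i(Z(r_{i+1})-Z(r_i))$, and for a uniform limit $F$ of step functions on $(s,t]$ the integral $\int_s^tF(r)\,dZ(r)$ is the random variable, unique up to null sets, to which the integrals of every sequence of step functions converging uniformly to $F$ on $(s,t]$ converge in probability. -/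

import Mathlib

open MeasureTheory ProbabilityTheory Filter Set
open scoped Topology NNReal

/-- A path is càdlàg: right-continuous with left limits at every point. -/
def IsCadlagPath {T E : Type*} [TopologicalSpace T] [LinearOrder T] [TopologicalSpace E]
    (x : T → E) : Prop :=
  ∀ t, ContinuousWithinAt x (Ici t) t ∧ ∃ l, Tendsto x (𝓝[<] t) (𝓝 l)

section Levy

variable {Ω E : Type*} [MeasurableSpace Ω]
  [NormedAddCommGroup E] [InnerProductSpace ℝ E] [MeasurableSpace E]

/-- A Lévy process on `[0, ∞)`. -/
structure IsLevyProcess (X : ℝ≥0 → Ω → E) (P : Measure Ω) : Prop where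
  measurable : ∀ t, Measurable (X t)
  zero : ∀ᵐ ω ∂P, X 0 ω = 0
  indep_increments : HasIndepIncrements X P
  stationary : ∀ t h, IdentDistrib (fun ω => X (t + h) ω - X t ω) (X h) P P
  stoch_continuous : ∀ t, TendstoInMeasure P X (𝓝 t) (X t)
  cadlag : ∀ᵐ ω ∂P, IsCadlagPath (fun t => X t ω)

/-- A Lévy process indexed by `ℝ`: a Lévy process on `[0, ∞)`, extended to negative times so that
`(Z(t))_{t < 0}` is independent of `(Z(t))_{t ≥ 0}` and has the same law, as a process, as
`(-Z((-t)-))_{t < 0}`; the paths are càdlàg on all of `ℝ`. -/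
structure IsTwoSidedLevyProcess (Z : ℝ → Ω → E) (P : Measure Ω) : Prop where
  measurable : ∀ t, Measurable (Z t)
  levy : IsLevyProcess (fun t : ℝ≥0 => Z t) P
  indep_neg : IndepFun (fun ω (t : Iio (0 : ℝ)) => Z t ω) (fun ω (t : Ici (0 : ℝ)) => Z t ω) P
  copy_neg : IdentDistrib (fun ω (t : Iio (0 : ℝ)) => Z t ω)
    (fun ω (t : Iio (0 : ℝ)) => -Function.leftLim (fun u : ℝ => Z u ω) (-(t : ℝ))) P P
  cadlag : ∀ᵐ ω ∂P, IsCadlagPath (fun t => Z t ω)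

/-- `η` is the exponent of the Lévy process `Z`: the characteristic function of `Z(u)` is
`a ↦ exp (-u η(a))` for all `u ≥ 0`. -/
def IsLevyExponent (Z : ℝ → Ω → E) (P : Measure Ω) (η : E → ℂ) : Prop :=
  ∀ u : ℝ, 0 ≤ u → ∀ a : E, charFun (P.map (Z u)) a = Complex.exp (-(u * η a))

/-- An operator-valued step function `∑ i < n, val i • 1_{(node i, node (i + 1)]}` on `(s, t]`,
with nodes `s = node 0 ≤ node 1 ≤ ⋯ ≤ node n = t`. -/
structure OperatorStep (E : Type*) [NormedAddCommGroup E] [InnerProductSpace ℝ E] (s t : ℝ) where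
  n : ℕ
  node : ℕ → ℝ
  node_mono : Monotone node
  node_zero : node 0 = s
  node_last : node n = t
  val : ℕ → E →L[ℝ] E

/-- The step function as a function of time. -/
noncomputable def OperatorStep.toFun {s t : ℝ} (G : OperatorStep E s t) (r : ℝ) : E →L[ℝ] E :=
  ∑ i ∈ Finset.range G.n, (Ioc (G.node i) (G.node (i + 1))).indicator (fun _ => G.val i) r

/-- The elementary stochastic integral `∫_s^t G(r) dZ(r)` of a step function. -/
noncomputable def OperatorStep.integral {s t : ℝ} (G : OperatorStep E s t)
    (Z : ℝ → Ω → E) (ω : Ω) : E :=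
  ∑ i ∈ Finset.range G.n, G.val i (Z (G.node (i + 1)) ω - Z (G.node i) ω)

/-- `Y` is (a version of) the stochastic integral `∫_s^t F(r) dZ(r)` of the deterministic
operator-valued integrand `F`: the map sending a step function to its elementary integral is
extended, by continuity from uniform convergence on `(s, t]` to convergence in probability, to the
uniform limits of step functions. The second clause says that `F` is such a limit; with the third
one it makes `Y` unique up to null sets. -/
def IsStochIntegral (P : Measure Ω) (Z : ℝ → Ω → E) (F : ℝ → E →L[ℝ] E) (s t : ℝ)
    (Y : Ω → E) : Prop :=
  AEMeasurable Y P ∧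
  (∃ G : ℕ → OperatorStep E s t, TendstoUniformlyOn (fun k => (G k).toFun) F atTop (Ioc s t)) ∧
  ∀ G : ℕ → OperatorStep E s t, TendstoUniformlyOn (fun k => (G k).toFun) F atTop (Ioc s t) →
    TendstoInMeasure P (fun k => (G k).integral Z) atTop Y

/-- `U` is the evolution operator of `A`: for each `s`, `U(·, s)` solves
`∂U(t,s)/∂t = A(t) U(t,s)` for `t ≥ s` with `U(s,s) = I` (one-sided derivative at `t = s`). -/
def IsEvolutionOperator (A : ℝ → E →L[ℝ] E) (U : ℝ → ℝ → E →L[ℝ] E) : Prop :=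
  ∀ s, U s s = ContinuousLinearMap.id ℝ E ∧
    ∀ t, s ≤ t → HasDerivWithinAt (fun τ => U τ s) (A t ∘L U t s) (Ici s) t

end Levy

/-! For a step integrand G the integral is a finite sum of operators applied to increments of Z. The
increments are independent and stationary, so its characteristic function is a product of
exponentials, namely exp(-∫ η(G(r)^T a) dr). A common refinement gives the same formula for the
difference of two elementary integrals. If two families of step functions have the same uniform
limit, then continuity of η, η(0) = 0 and dominated convergence send the characteristic function of
the difference to 1, and by Lévy's continuity theorem the difference tends to 0 in probability.
Hence the integrals along any uniformly convergent sequence of step functions are Cauchy in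
probability, their limit does not depend on the sequence, and the formula passes to the limit
(`tendstoInMeasure_integral_sub`, `exists_isStochIntegral`, `charFun_eq`).

Three inputs remain. The exponent comes from solving ψ(u+v) = ψ(u)ψ(v), and it is continuous in a.
Increments at negative times are reduced to positive ones by reflection, with the partition cut at
time 0. The integrand U(t,r)B(r) is continuous in r because U(t,·) is Lipschitz on compact
intervals, so it is a uniform limit of step functions. -/

/-! ### Convergence in probability and characteristic functions -/

section ConvergenceInMeasure

variable {Ω E : Type*} [MeasurableSpace Ω] {P : Measure Ω} [IsProbabilityMeasure P]
  [NormedAddCommGroup E] [MeasurableSpace E] [BorelSpace E]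

/-- Convergence in probability implies pointwise convergence of characteristic functions. -/
theorem MeasureTheory.TendstoInMeasure.tendsto_charFun [InnerProductSpace ℝ E] [SecondCountableTopology E]
    {ι : Type*} {l : Filter ι} [l.IsCountablyGenerated] {X : ι → Ω → E} {Y : Ω → E}
    (h : TendstoInMeasure P X l Y) (hX : ∀ i, AEMeasurable (X i) P) (hY : AEMeasurable Y P)
    (a : E) : Tendsto (fun i => charFun (P.map (X i)) a) l (𝓝 (charFun (P.map Y) a)) := by
  have h1 := (h.tendstoInDistribution_of_aemeasurable hX hY).tendsto
  simp_rw [charFun_eq_integral_innerProbChar]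
  exact (ProbabilityMeasure.tendsto_iff_forall_integral_rclike_tendsto ℂ).1 h1 (BoundedContinuousFunction.innerProbChar a)

/-- If the characteristic functions converge pointwise to `1`, then the random variables converge
to `0` in probability. -/
theorem tendstoInMeasure_zero_of_tendsto_charFun [InnerProductSpace ℝ E] [FiniteDimensional ℝ E]
    {ι : Type*} {l : Filter ι} [l.IsCountablyGenerated] {X : ι → Ω → E}
    (hX : ∀ i, AEMeasurable (X i) P)
    (h : ∀ a, Tendsto (fun i => charFun (P.map (X i)) a) l (𝓝 1)) :
    TendstoInMeasure P X l (fun _ => 0) := by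
  rw [tendstoInMeasure_iff_norm]
  intro ε hε
  refine tendsto_of_seq_tendsto fun u hu => ?_
  let μ : ℕ → ProbabilityMeasure E := fun n =>
    ⟨P.map (X (u n)), Measure.isProbabilityMeasure_map (hX _)⟩
  let μ₀ : ProbabilityMeasure E := ⟨Measure.dirac 0, inferInstance⟩
  have hμ : Tendsto μ atTop (𝓝 μ₀) := by
    refine ProbabilityMeasure.tendsto_of_tendsto_charFun fun a => ?_
    have : charFun (μ₀ : Measure E) a = 1 := by simp [μ₀, charFun_dirac]
    rw [this]
    exact (h a).comp hu
  -- Portmanteau: the closed set of points of norm at least ε has no mass under the limit law δ₀.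
  have hclosed : IsClosed {x : E | ε ≤ ‖x‖} := isClosed_le continuous_const continuous_norm
  have hlim := ProbabilityMeasure.limsup_measure_closed_le_of_tendsto hμ hclosed
  have h0 : (μ₀ : Measure E) {x : E | ε ≤ ‖x‖} = 0 := by
    simp [μ₀, Measure.dirac_apply' _ hclosed.measurableSet, hε]
  rw [h0] at hlim
  have heq : ∀ n, P {ω | ε ≤ ‖X (u n) ω - 0‖} = (μ n : Measure E) {x : E | ε ≤ ‖x‖} := by
    intro n
    simp only [sub_zero]
    exact (Measure.map_apply_of_aemeasurable (hX _) hclosed.measurableSet).symm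
  simp only [Function.comp_def, heq]
  exact tendsto_of_le_liminf_of_limsup_le (by simp) hlim

-- Transfers a limit in probability from a subsequence to the whole sequence, and from one
-- approximating sequence of integrals to another.
omit [IsProbabilityMeasure P] [MeasurableSpace E] [BorelSpace E] in
theorem MeasureTheory.TendstoInMeasure.add_of_zero {ι : Type*} {l : Filter ι} {X Y : ι → Ω → E}
    {W : Ω → E} (hX : TendstoInMeasure P X l W)
    (hY : TendstoInMeasure P (fun i ω => Y i ω - X i ω) l (fun _ => 0)) :
    TendstoInMeasure P Y l W := by
  rw [tendstoInMeasure_iff_norm] at *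
  intro ε hε
  have h := (hX (ε / 2) (half_pos hε)).add (hY (ε / 2) (half_pos hε))
  rw [add_zero] at h
  refine tendsto_of_tendsto_of_tendsto_of_le_of_le tendsto_const_nhds h (fun _ => zero_le)
    fun i => ?_
  refine (measure_mono fun ω hω => ?_).trans (measure_union_le _ _)
  simp only [mem_ofPred_eq, mem_union, sub_zero] at hω ⊢
  by_contra! hc
  have : ‖Y i ω - W ω‖ ≤ ‖Y i ω - X i ω‖ + ‖X i ω - W ω‖ := norm_sub_le_norm_sub_add_norm_sub ..
  linarith

/-- A sequence that is Cauchy in probability converges in probability. -/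
theorem exists_tendstoInMeasure_of_cauchy [CompleteSpace E] [SecondCountableTopology E]
    {X : ℕ → Ω → E} (hX : ∀ n, AEMeasurable (X n) P)
    (h : TendstoInMeasure P (fun (p : ℕ × ℕ) ω => X p.1 ω - X p.2 ω) atTop (fun _ => 0)) :
    ∃ Y : Ω → E, AEMeasurable Y P ∧ TendstoInMeasure P X atTop Y := by
  have hN : ∀ k : ℕ, ∃ N, ∀ n ≥ N, ∀ m ≥ N,
      P {ω | (1 / 2 : ℝ) ^ k ≤ ‖X n ω - X m ω‖} ≤ (1 / 2 : ENNReal) ^ k := by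
    intro k
    have h1 := (tendstoInMeasure_iff_norm.1 h) ((1 / 2 : ℝ) ^ k) (by positivity)
    have h2 := h1.eventually_le_const (u := (1 / 2 : ENNReal) ^ k)
      (ENNReal.pow_pos (by simp) k)
    obtain ⟨⟨a, b⟩, hab⟩ := eventually_atTop.1 h2
    refine ⟨max a b, fun n hn m hm => ?_⟩
    simpa using hab (n, m) ⟨(le_max_left _ _).trans hn, (le_max_right _ _).trans hm⟩
  choose N hN using hN
  -- Partial sums of N i + 1 are strictly increasing and dominate N. Along φ successive differences
  -- are summably small, so Borel–Cantelli gives almost sure convergence.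
  obtain ⟨φ, hφ, hφN⟩ : ∃ φ : ℕ → ℕ, StrictMono φ ∧ ∀ k, N k ≤ φ k := by
    refine ⟨fun k => ∑ i ∈ Finset.range (k + 1), (N i + 1), strictMono_nat_of_lt_succ fun k => ?_,
      fun k => ?_⟩
    · rw [Finset.sum_range_succ _ (k + 1)]; omega
    · dsimp only
      rw [Finset.sum_range_succ]; omega
  have hle : ∀ k, P {ω | (1 / 2 : ℝ) ^ k ≤ ‖X (φ k) ω - X (φ (k + 1)) ω‖} ≤ (1 / 2 : ENNReal) ^ k :=
    fun k => hN k (φ k) (hφN k) (φ (k + 1)) ((hφN k).trans (hφ.monotone k.le_succ))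
  have hsum : ∑' k, P {ω | (1 / 2 : ℝ) ^ k ≤ ‖X (φ k) ω - X (φ (k + 1)) ω‖} ≠ ⊤ := by
    have hgeom : ∑' k : ℕ, (1 / 2 : ENNReal) ^ k ≠ ⊤ := by
      rw [ENNReal.tsum_geometric]
      simp
    exact ne_top_of_le_ne_top hgeom (ENNReal.tsum_le_tsum hle)
  have hae : ∀ᵐ ω ∂P, ∃ y, Tendsto (fun k => X (φ k) ω) atTop (𝓝 y) := by
    filter_upwards [ae_eventually_notMem hsum] with ω hω
    obtain ⟨K, hK⟩ := eventually_atTop.1 hω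
    have hc : CauchySeq (fun k => X (φ (k + K)) ω) := by
      refine cauchySeq_of_le_geometric (1 / 2 : ℝ) 1 (by norm_num) fun k => ?_
      have := hK (k + K) (by omega)
      simp only [not_le] at this
      rw [dist_eq_norm, one_mul, show k + 1 + K = k + K + 1 by ring]
      exact this.le.trans (pow_le_pow_of_le_one (by norm_num) (by norm_num) (by omega))
    obtain ⟨y, hy⟩ := cauchySeq_tendsto_of_complete hc
    exact ⟨y, (tendsto_add_atTop_iff_nat (f := fun k => X (φ k) ω) K).1 hy⟩
  obtain ⟨Y, hYm, hY⟩ := measurable_limit_of_tendsto_metrizable_ae (fun k => hX (φ k)) hae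
  refine ⟨Y, hYm.aemeasurable, ?_⟩
  have h1 : TendstoInMeasure P (fun k => X (φ k)) atTop Y :=
    tendstoInMeasure_of_tendsto_ae (fun k => (hX _).aestronglyMeasurable) hY
  have h2 : Tendsto (fun k => (k, φ k)) atTop (atTop : Filter (ℕ × ℕ)) := by
    rw [← prod_atTop_atTop_eq]
    exact tendsto_id.prodMk hφ.tendsto_atTop
  have h3 : TendstoInMeasure P (fun k ω => X k ω - X (φ k) ω) atTop (fun _ => 0) :=
    fun ε hε => by
      have h4 := (h ε hε).comp h2
      exact h4
  exact h1.add_of_zero h3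

end ConvergenceInMeasure

/-! ### Existence, uniqueness and continuity of the exponent -/

section Exponent

/-- A continuous multiplicative function on `[0, ∞)` with values in `ℂ` is an exponential. -/
theorem exists_eq_exp_of_mul_of_continuous {ψ : ℝ → ℂ} (hc : Continuous ψ) (h0 : ψ 0 = 1)
    (hmul : ∀ u v, 0 ≤ u → 0 ≤ v → ψ (u + v) = ψ u * ψ v) :
    ∃ z : ℂ, ∀ u, 0 ≤ u → ψ u = Complex.exp (-(u * z)) := by
  have hint : ∀ a b, IntervalIntegrable ψ volume a b := fun a b => hc.intervalIntegrable a b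
  have hderiv : ∀ x, HasDerivAt (fun y => ∫ v in (0 : ℝ)..y, ψ v) (ψ x) x := fun x =>
    intervalIntegral.integral_hasDerivAt_right (hint _ _)
      hc.stronglyMeasurable.stronglyMeasurableAtFilter hc.continuousAt
  -- The primitive of ψ has derivative ψ 0 = 1 at 0, so it is nonzero just to the right of 0.
  obtain ⟨h, hh, hne⟩ : ∃ h : ℝ, 0 < h ∧ ∫ v in (0 : ℝ)..h, ψ v ≠ 0 := by
    have h1 := (hderiv 0).eventually_ne (c := 0) (by simp [h0])
    have h2 : ∀ᶠ h in 𝓝[>] (0 : ℝ), ∫ v in (0 : ℝ)..h, ψ v ≠ 0 :=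
      h1.filter_mono (nhdsWithin_mono _ fun x hx => ne_of_gt hx)
    obtain ⟨h, h3, h4⟩ := (h2.and self_mem_nhdsWithin).exists
    exact ⟨h, h4, h3⟩
  set c := ∫ v in (0 : ℝ)..h, ψ v with hcdef
  -- Integrating ψ(u+v) = ψ(u)ψ(v) over v ∈ [0,h] writes ψ as a difference of primitives, so ψ is
  -- differentiable and solves ψ' = wψ.
  have hshift : ∀ u, 0 ≤ u →
      ψ u = ((∫ v in (0 : ℝ)..(u + h), ψ v) - ∫ v in (0 : ℝ)..u, ψ v) / c := by
    intro u hu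
    rw [eq_div_iff hne, intervalIntegral.integral_interval_sub_left (hint _ _) (hint _ _), hcdef,
      ← intervalIntegral.integral_const_mul]
    have : ∫ v in u..(u + h), ψ v = ∫ v in (0 : ℝ)..h, ψ (u + v) := by
      rw [intervalIntegral.integral_comp_add_left ψ u, add_zero]
    rw [this]
    refine intervalIntegral.integral_congr fun v hv => ?_
    rw [uIcc_of_le hh.le] at hv
    exact (hmul u v hu hv.1).symm
  set w := (ψ h - 1) / c with hw
  have hd : ∀ u, 0 ≤ u → HasDerivWithinAt ψ (w * ψ u) (Ici u) u := by
    intro u hu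
    have h1 : HasDerivAt (fun y => ((∫ v in (0 : ℝ)..(y + h), ψ v) - ∫ v in (0 : ℝ)..y, ψ v) / c)
        ((ψ (u + h) - ψ u) / c) u :=
      (((hderiv (u + h)).comp_add_const u h).sub (hderiv u)).div_const c
    have h2 : (ψ (u + h) - ψ u) / c = w * ψ u := by
      rw [hmul u h hu hh.le, hw]; ring
    rw [h2] at h1
    exact h1.hasDerivWithinAt.congr (fun y hy => hshift y (hu.trans hy)) (hshift u hu)
  refine ⟨-w, fun u hu => ?_⟩
  have hexp : ∀ x : ℝ, HasDerivAt (fun y : ℝ => Complex.exp (-(y * w)))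
      (Complex.exp (-(x * w)) * (-w)) x := fun x => by
    have := (((hasDerivAt_id x).ofReal_comp.mul_const w).neg).cexp
    simpa using this
  have hconst := constant_of_has_deriv_right_zero (a := 0) (b := u)
    (f := fun x => ψ x * Complex.exp (-(x * w)))
    (by fun_prop) (fun x hx => by
      have := (hd x hx.1).mul (hexp x).hasDerivWithinAt
      convert! this using 1
      ring) u ⟨hu, le_rfl⟩
  simp only [h0, Complex.ofReal_zero, zero_mul, neg_zero, Complex.exp_zero, mul_one] at hconst
  rw [Complex.exp_neg] at hconst
  rw [mul_neg, neg_neg]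
  exact (mul_inv_eq_one₀ (Complex.exp_ne_zero _)).1 hconst

/-- The right derivative at u = 0 recovers the exponent, so no branch of the logarithm has to be
chosen. -/
theorem eq_of_forall_exp_neg_mul_eq {z w : ℂ}
    (h : ∀ u : ℝ, 0 ≤ u → Complex.exp (-(u * z)) = Complex.exp (-(u * w))) : z = w := by
  have hexp : ∀ z : ℂ, HasDerivWithinAt (fun y : ℝ => Complex.exp (-(y * z))) (-z) (Ici 0) 0 := by
    intro z
    have := (((hasDerivAt_id (0 : ℝ)).ofReal_comp.mul_const z).neg).cexp.hasDerivWithinAt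
      (s := Ici 0)
    simpa using this
  have h1 := (hexp w).congr (fun y hy => h y hy) (h 0 le_rfl)
  exact neg_injective ((uniqueDiffOn_Ici (0 : ℝ) 0 self_mem_Ici).eq_deriv _ (hexp z) h1)

variable {Ω E : Type*} [MeasurableSpace Ω] {P : Measure Ω} [IsProbabilityMeasure P]
  [NormedAddCommGroup E] [InnerProductSpace ℝ E] [MeasurableSpace E] [BorelSpace E]
  [SecondCountableTopology E] {Z : ℝ → Ω → E} {η : E → ℂ}

omit [IsProbabilityMeasure P] [BorelSpace E] [SecondCountableTopology E] in
theorem IsLevyExponent.unique {η' : E → ℂ} (h : IsLevyExponent Z P η) (h' : IsLevyExponent Z P η') :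
    η = η' :=
  funext fun a => eq_of_forall_exp_neg_mul_eq fun u hu => (h u hu a).symm.trans (h' u hu a)

/-- For fixed a, independent stationary increments make u ↦ E exp(i⟨a, Z(u)⟩) multiplicative, and
stochastic continuity makes it continuous. -/
theorem IsLevyProcess.exists_exponent (hX : IsLevyProcess (fun t : ℝ≥0 => Z t) P) :
    ∃ η : E → ℂ, IsLevyExponent Z P η := by
  suffices h : ∀ a, ∃ z : ℂ, ∀ u : ℝ, 0 ≤ u → charFun (P.map (Z u)) a = Complex.exp (-(u * z)) by
    choose η hη using h
    exact ⟨η, fun u hu a => hη a u hu⟩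
  intro a
  let φ : ℝ≥0 → ℂ := fun u => charFun (P.map (Z u)) a
  have hφc : Continuous φ := continuous_iff_continuousAt.2 fun t =>
    (hX.stoch_continuous t).tendsto_charFun (fun i => (hX.measurable i).aemeasurable)
      (hX.measurable t).aemeasurable a
  have hφ0 : φ 0 = 1 := by
    have : P.map (Z (0 : ℝ≥0)) = Measure.dirac 0 := by
      rw [Measure.map_congr (g := fun _ => (0 : E)) hX.zero, Measure.map_const]; simp
    simp only [φ]
    rw [this, charFun_dirac]; simp
  have hφmul : ∀ u v, φ (u + v) = φ u * φ v := by
    intro u v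
    have hind : IndepFun (Z u) (fun ω => Z ((u + v : ℝ≥0) : ℝ) ω - Z u ω) P :=
      hX.indep_increments.indepFun_eval_sub (zero_le (a := u)) (le_add_of_nonneg_right zero_le)
        hX.zero
    have hm1 : Measurable (Z u) := hX.measurable u
    have hm2 : Measurable (Z (u + v : ℝ≥0)) := hX.measurable (u + v)
    have h1 := congrFun (hind.charFun_map_fun_add_eq_mul
      (Y := fun ω => Z ((u + v : ℝ≥0) : ℝ) ω - Z u ω) hm1.aemeasurable
      (hm2.sub hm1).aemeasurable) a
    simp only [add_sub_cancel, Pi.mul_apply] at h1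
    have h2 := (hX.stationary u v).map_eq
    simp only [φ]
    rw [h1, h2]
  obtain ⟨z, hz⟩ := exists_eq_exp_of_mul_of_continuous (ψ := fun u => φ u.toNNReal)
    (hφc.comp continuous_real_toNNReal) (by simpa using hφ0)
    (fun u v hu hv => by rw [Real.toNNReal_add hu hv, hφmul])
  refine ⟨z, fun u hu => ?_⟩
  rw [← hz u hu]
  simp [φ, Real.coe_toNNReal u hu]

omit [BorelSpace E] [SecondCountableTopology E] in
theorem IsLevyExponent.map_zero (h : IsLevyExponent Z P η) (hZ : ∀ t, Measurable (Z t)) :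
    η 0 = 0 := by
  refine eq_of_forall_exp_neg_mul_eq fun u hu => ?_
  have := Measure.isProbabilityMeasure_map (μ := P) (hZ u).aemeasurable
  rw [← h u hu 0]
  simp [charFun_zero]

/-- η(a) = (1 - exp(-bη(a))) / ∫₀ᵇ exp(-uη(a)) du whenever the denominator is nonzero. Numerator and
denominator are built from characteristic functions, hence continuous in a; a small b > 0 keeps the
denominator nonzero near a₀. -/
theorem IsLevyExponent.continuous (h : IsLevyExponent Z P η) (hZ : ∀ t, Measurable (Z t)) :
    Continuous η := by
  have hprob : ∀ u, IsProbabilityMeasure (P.map (Z u)) := fun u =>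
    Measure.isProbabilityMeasure_map (hZ u).aemeasurable
  have hchar : ∀ u : ℝ, 0 ≤ u → Continuous fun a => Complex.exp (-(u * η a)) := fun u hu => by
    have : (fun a => Complex.exp (-(u * η a))) = charFun (P.map (Z u)) :=
      funext fun a => (h u hu a).symm
    rw [this]
    exact continuous_charFun
  have hexpc : ∀ z : ℂ, Continuous fun u : ℝ => Complex.exp (-(u * z)) := fun z => by fun_prop
  have hderiv : ∀ (z : ℂ) (x : ℝ),
      HasDerivAt (fun y : ℝ => -Complex.exp (-(y * z))) (Complex.exp (-(x * z)) * z) x := by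
    intro z x
    have := ((((hasDerivAt_id x).ofReal_comp.mul_const z).neg).cexp).fun_neg
    simpa using this
  have hFTC : ∀ (z : ℂ) (b : ℝ), (∫ u in (0 : ℝ)..b, Complex.exp (-(u * z))) * z =
      1 - Complex.exp (-(b * z)) := by
    intro z b
    rw [← intervalIntegral.integral_mul_const,
      intervalIntegral.integral_eq_sub_of_hasDerivAt (fun x _ => hderiv z x)
        (((hexpc z).mul continuous_const).intervalIntegrable _ _)]
    simp
    ring
  have hI : ∀ b : ℝ, 0 ≤ b → Continuous fun a => ∫ u in (0 : ℝ)..b, Complex.exp (-(u * η a)) := by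
    intro b hb
    refine intervalIntegral.continuous_of_dominated_interval (bound := fun _ => 1)
      (fun a => (hexpc _).aestronglyMeasurable) (fun a => ae_of_all _ fun u hu => ?_)
      intervalIntegrable_const (ae_of_all _ fun u hu => ?_)
    · rw [uIoc_of_le hb] at hu
      rw [← h u hu.1.le a]
      exact norm_charFun_le_one a
    · rw [uIoc_of_le hb] at hu
      exact hchar u hu.1.le
  refine continuous_iff_continuousAt.2 fun a₀ => ?_
  obtain ⟨b, hb, hne⟩ : ∃ b : ℝ, 0 < b ∧ ∫ u in (0 : ℝ)..b, Complex.exp (-(u * η a₀)) ≠ 0 := by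
    have h1 : HasDerivAt (fun y => ∫ u in (0 : ℝ)..y, Complex.exp (-(u * η a₀)))
        (Complex.exp (-((0 : ℝ) * η a₀))) 0 :=
      intervalIntegral.integral_hasDerivAt_right ((hexpc _).intervalIntegrable _ _)
        (hexpc _).stronglyMeasurable.stronglyMeasurableAtFilter (hexpc _).continuousAt
    have h2 : ∀ᶠ h in 𝓝[>] (0 : ℝ), ∫ u in (0 : ℝ)..h, Complex.exp (-(u * η a₀)) ≠ 0 :=
      (h1.eventually_ne (c := 0) (by simp)).filter_mono
        (nhdsWithin_mono _ fun x hx => ne_of_gt hx)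
    obtain ⟨h, h3, h4⟩ := (h2.and self_mem_nhdsWithin).exists
    exact ⟨h, h4, h3⟩
  have hdiv : ContinuousAt (fun a => (1 - Complex.exp (-(b * η a))) /
      ∫ u in (0 : ℝ)..b, Complex.exp (-(u * η a))) a₀ :=
    (continuous_const.sub (hchar b hb.le)).continuousAt.div (hI b hb.le).continuousAt hne
  refine hdiv.congr ?_
  filter_upwards [(hI b hb.le).continuousAt.eventually_ne hne] with a ha
  rw [← hFTC, mul_div_cancel_left₀ _ ha]

end Exponent

/-! ### Joint law of increments over the whole real line -/

section Increments

variable {Ω E : Type*} [MeasurableSpace Ω] {P : Measure Ω} [IsProbabilityMeasure P]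
  [NormedAddCommGroup E] [InnerProductSpace ℝ E] [MeasurableSpace E] [BorelSpace E]
  [SecondCountableTopology E] {Z : ℝ → Ω → E} {η : E → ℂ}

omit [IsProbabilityMeasure P] [InnerProductSpace ℝ E] [BorelSpace E] [SecondCountableTopology E] in
theorem map_zero_ae_of_isLevyProcess (hX : IsLevyProcess (fun t : ℝ≥0 => Z t) P) : ∀ᵐ ω ∂P, Z 0 ω = 0 := by
  simpa using hX.zero

omit [IsProbabilityMeasure P] in
/-- The characteristic function of a linear combination of increments of a Lévy process. -/
theorem IsLevyProcess.charFun_sum_increments [CompleteSpace E]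
    (hX : IsLevyProcess (fun t : ℝ≥0 => Z t) P) (hη : IsLevyExponent Z P η)
    {p : ℕ → ℝ≥0} (hp : Monotone p) (m : ℕ) (L : ℕ → E →L[ℝ] E) (a : E) :
    charFun (P.map fun ω => ∑ k ∈ Finset.range m, L k (Z (p (k + 1)) ω - Z (p k) ω)) a =
      Complex.exp (-∑ k ∈ Finset.range m,
        (((p (k + 1) : ℝ) - p k : ℝ) : ℂ) * η ((L k).adjoint a)) := by
  have hm : ∀ k, Measurable (fun ω => Z (p (k + 1)) ω - Z (p k) ω) := fun k =>
    (hX.measurable _).sub (hX.measurable _)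
  have hind : iIndepFun (fun k ω => L k (Z (p (k + 1)) ω - Z (p k) ω)) P :=
    (hX.indep_increments.nat hp).comp (fun k => L k) (fun k => (L k).measurable)
  have hLm : ∀ k, AEMeasurable (fun ω => L k (Z (p (k + 1)) ω - Z (p k) ω)) P := fun k =>
    ((L k).measurable.comp (hm k)).aemeasurable
  have hprod := congrFun (iIndepFun.charFun_map_fun_finsetSum_eq_prod (s := Finset.range m)
    (fun k _ => hLm k) (hind.restrict _)) a
  refine hprod.trans ?_
  rw [Finset.prod_apply, ← Finset.sum_neg_distrib, Complex.exp_sum]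
  refine Finset.prod_congr rfl fun k _ => ?_
  have hle := hp k.le_succ
  have hst := (hX.stationary (p k) (p (k + 1) - p k)).map_eq
  simp only [add_tsub_cancel_of_le hle] at hst
  have hcomp : P.map (fun ω => L k (Z (p (k + 1)) ω - Z (p k) ω)) =
      (P.map (Z (p (k + 1) - p k : ℝ≥0))).map (L k) := by
    rw [← hst, Measure.map_map (L k).measurable (hm k)]; rfl
  rw [hcomp, ← NNReal.coe_sub hle, ← hη _ (NNReal.coe_nonneg _), charFun_apply, charFun_apply,
    integral_map (L k).measurable.aemeasurable (by fun_prop)]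
  simp_rw [ContinuousLinearMap.adjoint_inner_right]

omit [InnerProductSpace ℝ E] in
/-- At a fixed positive time a Lévy process almost surely does not jump. -/
theorem IsTwoSidedLevyProcess.leftLim_ae_eq (hZ : IsTwoSidedLevyProcess Z P) {t : ℝ} (ht : 0 < t) :
    ∀ᵐ ω ∂P, Function.leftLim (fun u => Z u ω) t = Z t ω := by
  lift t to ℝ≥0 using ht.le
  -- Along times increasing strictly to t, the values tend almost surely to the left limit and in
  -- probability to Z(t); the two limits agree almost surely.
  obtain ⟨u, -, hu, hlim⟩ := exists_seq_strictMono_tendsto' (show (0 : ℝ≥0) < t from ht)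
  have h1 : TendstoInMeasure P (fun n => Z (u n)) atTop (Z t) := fun ε hε =>
    (hZ.levy.stoch_continuous t ε hε).comp hlim
  have hae : ∀ᵐ ω ∂P, Tendsto (fun n => Z (u n) ω) atTop
      (𝓝 (Function.leftLim (fun u => Z u ω) t)) := by
    filter_upwards [hZ.cadlag] with ω hω
    obtain ⟨l, hl⟩ := (hω t).2
    rw [leftLim_eq_of_tendsto hl]
    refine hl.comp (tendsto_nhdsWithin_iff.2 ⟨?_, Eventually.of_forall fun n => (hu n).2⟩)
    exact (NNReal.continuous_coe.tendsto t).comp hlim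
  have h2 := tendstoInMeasure_of_tendsto_ae
    (fun n => (hZ.measurable (u n)).aestronglyMeasurable) hae
  exact tendstoInMeasure_ae_unique h2 h1

/-- The finite-dimensional linear functionals of a two-sided Lévy process at negative times,
reflected to positive times. -/
theorem IsTwoSidedLevyProcess.charFun_sum_increments_neg [CompleteSpace E]
    (hZ : IsTwoSidedLevyProcess Z P) (hη : IsLevyExponent Z P η)
    {q : ℕ → ℝ} (hq : Monotone q) {j : ℕ} (hj : q j = 0) (L : ℕ → E →L[ℝ] E) (a : E) :
    ∃ g : (Iio (0 : ℝ) → E) → E, Measurable g ∧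
      (∀ᵐ ω ∂P, g (fun t : Iio (0 : ℝ) => Z t ω) =
        ∑ k ∈ Finset.range j, L k (Z (q (k + 1)) ω - Z (q k) ω)) ∧
      charFun (P.map fun ω => g (fun t : Iio (0 : ℝ) => Z t ω)) a =
        Complex.exp (-∑ k ∈ Finset.range j,
          ((q (k + 1) - q k : ℝ) : ℂ) * η ((L k).adjoint a)) := by
  classical
  -- The default 0 stands for Z(0), which is almost surely 0: among the nodes q k with k ≤ j it is
  -- used only when q k = 0.
  let e : ℝ → (Iio (0 : ℝ) → E) → E := fun t x => if h : t < 0 then x ⟨t, h⟩ else 0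
  have he : ∀ t, Measurable (e t) := fun t => by
    by_cases h : t < 0
    · simpa only [e, h, dite_true] using measurable_pi_apply _
    · simpa only [e, h, dite_false] using measurable_const
  let g : (Iio (0 : ℝ) → E) → E := fun x =>
    ∑ k ∈ Finset.range j, L k (e (q (k + 1)) x - e (q k) x)
  have hg : Measurable g := Finset.measurable_sum _ fun k _ =>
    (L k).measurable.comp ((he _).sub (he _))
  have h0 := map_zero_ae_of_isLevyProcess hZ.levy
  have hqle : ∀ k ≤ j, q k ≤ 0 := fun k hk => hj ▸ hq hk
  refine ⟨g, hg, ?_, ?_⟩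
  · filter_upwards [h0] with ω hω
    have hev : ∀ k ≤ j, e (q k) (fun t : Iio (0 : ℝ) => Z t ω) = Z (q k) ω := by
      intro k hk
      by_cases h : q k < 0
      · simp only [e, h, dite_true]
      · simp only [e, h, dite_false]
        rw [le_antisymm (hqle k hk) (not_lt.1 h), hω]
    refine Finset.sum_congr rfl fun k hk => ?_
    have := Finset.mem_range.1 hk
    rw [hev k (by omega), hev (k + 1) (by omega)]
  · have hlaw := (hZ.copy_neg.comp hg).map_eq
    -- Reflected nodes in reverse order. Reversal and the minus sign in -Z((-t)-) cancel, so
    -- increments of the reflected copy are forward increments of Z on [0, ∞).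
    let p : ℕ → ℝ≥0 := fun i => (-q (j - i)).toNNReal
    have hp : Monotone p := fun i i' hi =>
      Real.toNNReal_mono (neg_le_neg (hq (Nat.sub_le_sub_left hi j)))
    have hpq : ∀ k ≤ j, (p (j - k) : ℝ) = -q k := by
      intro k hk
      simp only [p, Nat.sub_sub_self hk]
      exact Real.coe_toNNReal _ (neg_nonneg.2 (hqle k hk))
    have hleft : ∀ᵐ ω ∂P, ∀ k ≤ j,
        e (q k) (fun t : Iio (0 : ℝ) => -Function.leftLim (fun u : ℝ => Z u ω) (-(t : ℝ))) =
          -Z (p (j - k)) ω := by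
      rw [ae_all_iff]
      intro k
      by_cases h : q k < 0
      · filter_upwards [hZ.leftLim_ae_eq (neg_pos.2 h)] with ω hω hk
        simp only [e, h, dite_true]
        rw [hω, hpq k hk]
      · filter_upwards [h0] with ω hω hk
        simp only [e, h, dite_false]
        rw [hpq k hk, le_antisymm (hqle k hk) (not_lt.1 h), neg_zero, hω, neg_zero]
    have hsum : (fun ω => g (fun t : Iio (0 : ℝ) =>
        -Function.leftLim (fun u : ℝ => Z u ω) (-(t : ℝ)))) =ᵐ[P]
        fun ω => ∑ i ∈ Finset.range j, L (j - 1 - i) (Z (p (i + 1)) ω - Z (p i) ω) := by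
      filter_upwards [hleft] with ω hω
      simp only [g]
      rw [← Finset.sum_range_reflect]
      refine Finset.sum_congr rfl fun i hi => ?_
      have := Finset.mem_range.1 hi
      rw [hω _ (by omega), hω _ (by omega), show j - (j - 1 - i + 1) = i by omega,
        show j - (j - 1 - i) = i + 1 by omega]
      congr 1
      abel
    have hlaw' : P.map (fun ω => g (fun t : Iio (0 : ℝ) => Z t ω)) =
        P.map (fun ω => ∑ i ∈ Finset.range j, L (j - 1 - i) (Z (p (i + 1)) ω - Z (p i) ω)) :=
      hlaw.trans (Measure.map_congr hsum)
    rw [hlaw', hZ.levy.charFun_sum_increments hη hp j (fun i => L (j - 1 - i)) a]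
    congr 2
    rw [← Finset.sum_range_reflect]
    refine Finset.sum_congr rfl fun i hi => ?_
    have := Finset.mem_range.1 hi
    have h1 := hpq i (by omega)
    have h2 := hpq (i + 1) (by omega)
    rw [show j - i = j - 1 - i + 1 by omega] at h1
    rw [show j - (i + 1) = j - 1 - i by omega] at h2
    rw [h1, h2, show j - 1 - (j - 1 - i) = i by omega]
    congr 2
    ring

/-- The characteristic function of a linear combination of increments of a two-sided Lévy process
along an increasing sequence of times that contains `0`. -/
theorem IsTwoSidedLevyProcess.charFun_sum_increments [CompleteSpace E]
    (hZ : IsTwoSidedLevyProcess Z P) (hη : IsLevyExponent Z P η)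
    {q : ℕ → ℝ} (hq : Monotone q) {j m : ℕ} (hjm : j ≤ m) (hj : q j = 0) (L : ℕ → E →L[ℝ] E)
    (a : E) :
    charFun (P.map fun ω => ∑ k ∈ Finset.range m, L k (Z (q (k + 1)) ω - Z (q k) ω)) a =
      Complex.exp (-∑ k ∈ Finset.range m,
        ((q (k + 1) - q k : ℝ) : ℂ) * η ((L k).adjoint a)) := by
  obtain ⟨g, hg, hgeq, hgchar⟩ := hZ.charFun_sum_increments_neg hη hq hj L a
  obtain ⟨n, rfl⟩ := Nat.exists_eq_add_of_le hjm
  have hqnn : ∀ k, 0 ≤ q (j + k) := fun k => hj ▸ hq (Nat.le_add_right j k)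
  let f : (Ici (0 : ℝ) → E) → E := fun x =>
    ∑ k ∈ Finset.range n, L (j + k) (x ⟨q (j + (k + 1)), hqnn _⟩ - x ⟨q (j + k), hqnn _⟩)
  have hf : Measurable f := Finset.measurable_sum _ fun k _ =>
    (L _).measurable.comp ((measurable_pi_apply _).sub (measurable_pi_apply _))
  have hpos := hZ.levy.charFun_sum_increments hη (p := fun k => (q (j + k)).toNNReal)
    (fun i i' hi => Real.toNNReal_mono (hq (Nat.add_le_add_left hi j))) n (fun k => L (j + k)) a
  simp only [Real.coe_toNNReal _ (hqnn _)] at hpos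
  have hsplit : (fun ω => ∑ k ∈ Finset.range (j + n), L k (Z (q (k + 1)) ω - Z (q k) ω)) =ᵐ[P]
      fun ω => g (fun t : Iio (0 : ℝ) => Z t ω) + f (fun t : Ici (0 : ℝ) => Z t ω) := by
    filter_upwards [hgeq] with ω hω
    rw [hω, Finset.sum_range_add]
    rfl
  have hZm1 : Measurable (fun ω (t : Iio (0 : ℝ)) => Z t ω) :=
    measurable_pi_lambda _ fun t => hZ.measurable t
  have hZm2 : Measurable (fun ω (t : Ici (0 : ℝ)) => Z t ω) :=
    measurable_pi_lambda _ fun t => hZ.measurable t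
  have hmul := congrFun ((hZ.indep_neg.comp hg hf).charFun_map_fun_add_eq_mul
    (hg.comp hZm1).aemeasurable (hf.comp hZm2).aemeasurable) a
  rw [Measure.map_congr hsplit]
  refine hmul.trans ?_
  rw [Pi.mul_apply, Finset.sum_range_add, neg_add, Complex.exp_add]
  exact congrArg₂ (· * ·) hgchar hpos

end Increments

/-! ### Telescoping along refined partitions -/

section Refinement

/-- A finite set of reals is covered by an increasing sequence. -/
theorem Finset.exists_monotone_nodes (S : Finset ℝ) (hS : S.Nonempty) :
    ∃ (q : ℕ → ℝ) (m : ℕ), Monotone q ∧ ∀ x ∈ S, ∃ k ≤ m, q k = x := by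
  have hc := hS.card_pos
  refine ⟨fun k => S.orderEmbOfFin rfl ⟨min k (S.card - 1), by omega⟩, S.card - 1,
    fun i j hij => ?_, fun x hx => ?_⟩
  · refine (S.orderEmbOfFin rfl).monotone ?_
    simp only [Fin.mk_le_mk]
    omega
  · have hr : x ∈ Set.range (S.orderEmbOfFin rfl) := by rwa [Finset.range_orderEmbOfFin]
    obtain ⟨⟨i, hi⟩, rfl⟩ := hr
    have hmin : min i (S.card - 1) = i := by omega
    refine ⟨i, by omega, ?_⟩
    simp only [hmin]

/-- The condition compares values instead of indices, so that it can be matched with indicators of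
intervals. This costs nothing: an index k ≥ b meeting it has q (k + 1) = q k and a zero increment.
-/
theorem Monotone.sum_increments_le {M : Type*} [AddCommGroup M] {q : ℕ → ℝ} (hq : Monotone q)
    (z : ℝ → M) (m : ℕ) {b : ℕ} (hb : b ≤ m) :
    ∑ k ∈ Finset.range m, (if q (k + 1) ≤ q b then z (q (k + 1)) - z (q k) else 0) =
      z (q b) - z (q 0) := by
  induction m with
  | zero => obtain rfl := Nat.le_zero.1 hb; simp
  | succ m ih =>
    by_cases hbm : b ≤ m
    · rw [Finset.sum_range_succ, ih hbm]
      split_ifs with h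
      · have h1 : q m = q (m + 1) := le_antisymm (hq m.le_succ) (h.trans (hq hbm))
        rw [h1]; simp
      · simp
    · obtain rfl : b = m + 1 := by omega
      rw [← Finset.sum_range_sub (fun k => z (q k))]
      refine Finset.sum_congr rfl fun k hk => if_pos (hq ?_)
      have := Finset.mem_range.1 hk
      omega

theorem Monotone.sum_increments_Ioc {M : Type*} [AddCommGroup M] {q : ℕ → ℝ} (hq : Monotone q)
    (z : ℝ → M) (m : ℕ) {b c : ℕ} (hb : b ≤ m) (hc : c ≤ m) (hbc : q b ≤ q c) :
    ∑ k ∈ Finset.range m, (if q (k + 1) ∈ Ioc (q b) (q c) then z (q (k + 1)) - z (q k) else 0) =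
      z (q c) - z (q b) := by
  rw [show z (q c) - z (q b) = (z (q c) - z (q 0)) - (z (q b) - z (q 0)) by abel,
    ← hq.sum_increments_le z m hb, ← hq.sum_increments_le z m hc, ← Finset.sum_sub_distrib]
  refine Finset.sum_congr rfl fun k _ => ?_
  by_cases h1 : q (k + 1) ≤ q b
  · rw [if_neg (fun h => absurd h.1 (not_lt.2 h1)), if_pos (h1.trans hbc), if_pos h1, sub_self]
  · by_cases h2 : q (k + 1) ≤ q c
    · rw [if_pos ⟨not_le.1 h1, h2⟩, if_pos h2, if_neg h1, sub_zero]
    · rw [if_neg (fun h => h2 h.2), if_neg h2, if_neg h1, sub_zero]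

/-- No value of q lies strictly between q k and q (k + 1), so an interval with end points among the
nodes contains all of this piece or none of it. -/
theorem Monotone.mem_Ioc_iff_of_mem_Ioc {q : ℕ → ℝ} (hq : Monotone q) {k b c : ℕ} {r : ℝ}
    (hr : r ∈ Ioc (q k) (q (k + 1))) : r ∈ Ioc (q b) (q c) ↔ q (k + 1) ∈ Ioc (q b) (q c) := by
  constructor
  · rintro ⟨h1, h2⟩
    refine ⟨h1.trans_le hr.2, hq ?_⟩
    by_contra! h
    exact absurd (hr.1.trans_le h2) (not_lt.2 (hq (Nat.lt_succ_iff.1 h)))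
  · rintro ⟨h1, h2⟩
    refine ⟨lt_of_le_of_lt (hq ?_) hr.1, hr.2.trans h2⟩
    by_contra! h
    exact absurd h1 (not_lt.2 (hq h))

end Refinement

/-! ### Elementary integrals and their characteristic functions -/

namespace OperatorStep

variable {Ω E : Type*} [MeasurableSpace Ω] [NormedAddCommGroup E] [InnerProductSpace ℝ E]
  {s t : ℝ}

/-- The sequence `q 0, …, q m` contains all the nodes of the step function `G`. -/
def IsRefinedBy (G : OperatorStep E s t) (q : ℕ → ℝ) (m : ℕ) : Prop :=
  ∀ i ≤ G.n, ∃ k ≤ m, q k = G.node i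

theorem toFun_eq_of_mem_Ioc {G : OperatorStep E s t} {q : ℕ → ℝ} {m : ℕ}
    (hG : G.IsRefinedBy q m) (hq : Monotone q) {k : ℕ} {r : ℝ}
    (hr : r ∈ Ioc (q k) (q (k + 1))) : G.toFun r = G.toFun (q (k + 1)) := by
  refine Finset.sum_congr rfl fun i hi => ?_
  have hi := Finset.mem_range.1 hi
  obtain ⟨b, -, hb⟩ := hG i hi.le
  obtain ⟨c, -, hc⟩ := hG (i + 1) hi
  rw [← hb, ← hc]
  simp only [indicator_apply, hq.mem_Ioc_iff_of_mem_Ioc hr]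

omit [MeasurableSpace Ω] in
/-- The elementary integral can be computed along any refinement. -/
theorem integral_eq_sum_of_isRefinedBy {G : OperatorStep E s t} {q : ℕ → ℝ} {m : ℕ}
    (hG : G.IsRefinedBy q m) (hq : Monotone q) (Z : ℝ → Ω → E) (ω : Ω) :
    G.integral Z ω =
      ∑ k ∈ Finset.range m, G.toFun (q (k + 1)) (Z (q (k + 1)) ω - Z (q k) ω) := by
  simp only [integral, toFun, sum_apply]
  rw [Finset.sum_comm]
  refine Finset.sum_congr rfl fun i hi => ?_
  have hi := Finset.mem_range.1 hi
  obtain ⟨b, hbm, hb⟩ := hG i hi.le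
  obtain ⟨c, hcm, hc⟩ := hG (i + 1) hi
  have hbc : q b ≤ q c := by rw [hb, hc]; exact G.node_mono i.le_succ
  rw [← hb, ← hc, ← hq.sum_increments_Ioc (fun r => Z r ω) m hbm hcm hbc, map_sum]
  refine Finset.sum_congr rfl fun k _ => ?_
  by_cases h : q (k + 1) ∈ Ioc (q b) (q c)
  · rw [if_pos h, indicator_of_mem h]
  · rw [if_neg h, indicator_of_notMem h]; simp

theorem le (G : OperatorStep E s t) : s ≤ t :=
  G.node_zero.symm.trans_le ((G.node_mono (Nat.zero_le _)).trans_eq G.node_last)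

theorem toFun_eq_zero_of_notMem (G : OperatorStep E s t) {r : ℝ} (hr : r ∉ Ioc s t) :
    G.toFun r = 0 := by
  refine Finset.sum_eq_zero fun i hi => indicator_of_notMem (fun h => hr ?_) _
  have hi := Finset.mem_range.1 hi
  exact ⟨(G.node_zero.symm.trans_le (G.node_mono (Nat.zero_le i))).trans_lt h.1,
    h.2.trans ((G.node_mono hi).trans_eq G.node_last)⟩

theorem toFun_eq_val (G : OperatorStep E s t) {i : ℕ} (hi : i < G.n) {r : ℝ}
    (hr : r ∈ Ioc (G.node i) (G.node (i + 1))) : G.toFun r = G.val i := by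
  rw [toFun, Finset.sum_eq_single_of_mem i (Finset.mem_range.2 hi), indicator_of_mem hr]
  intro k _ hk
  refine indicator_of_notMem (fun h => ?_) _
  rcases lt_or_gt_of_ne hk with hlt | hlt
  · exact absurd (hr.1.trans_le h.2) (not_lt.2 (G.node_mono hlt))
  · exact absurd (h.1.trans_le hr.2) (not_lt.2 (G.node_mono hlt))

theorem exists_mem_Ioc (G : OperatorStep E s t) {r : ℝ} (hr : r ∈ Ioc s t) :
    ∃ i < G.n, r ∈ Ioc (G.node i) (G.node (i + 1)) := by
  classical
  have hex : ∃ k, r ≤ G.node k := ⟨G.n, hr.2.trans_eq G.node_last.symm⟩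
  have hpos : Nat.find hex ≠ 0 := by
    intro h
    have := Nat.find_spec hex
    rw [h, G.node_zero] at this
    exact absurd hr.1 (not_lt.2 this)
  obtain ⟨i, hi⟩ := Nat.exists_eq_succ_of_ne_zero hpos
  refine ⟨i, ?_, not_le.1 (Nat.find_min hex (by omega)), ?_⟩
  · have := Nat.find_min' hex (hr.2.trans_eq G.node_last.symm)
    omega
  · have := Nat.find_spec hex
    rwa [hi] at this

theorem stronglyMeasurable_toFun (G : OperatorStep E s t) : StronglyMeasurable G.toFun := by
  have : G.toFun = fun r => ∑ i ∈ Finset.range G.n,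
      (Ioc (G.node i) (G.node (i + 1))).indicator (fun _ => G.val i) r := rfl
  rw [this]
  exact Finset.stronglyMeasurable_fun_sum _ fun i _ =>
    stronglyMeasurable_const.indicator measurableSet_Ioc

theorem measurable_integral [MeasurableSpace E] [BorelSpace E] [SecondCountableTopology E]
    (G : OperatorStep E s t) {Z : ℝ → Ω → E} (hZ : ∀ t, Measurable (Z t)) :
    Measurable (G.integral Z) :=
  Finset.measurable_sum _ fun _ _ => (G.val _).measurable.comp ((hZ _).sub (hZ _))

/-- The zero step function. -/
def zero (E : Type*) [NormedAddCommGroup E] [InnerProductSpace ℝ E] (hst : s ≤ t) :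
    OperatorStep E s t where
  n := 1
  node i := if i = 0 then s else t
  node_mono := fun i j hij => by
    dsimp only
    split_ifs with h1 h2 <;> first | exact le_rfl | exact hst | omega
  node_zero := rfl
  node_last := rfl
  val _ := 0

@[simp]
theorem toFun_zero (hst : s ≤ t) (r : ℝ) : (zero E hst).toFun r = 0 := by
  simp [toFun, zero]

omit [MeasurableSpace Ω] in
@[simp]
theorem integral_zero (hst : s ≤ t) (Z : ℝ → Ω → E) (ω : Ω) : (zero E hst).integral Z ω = 0 := by
  simp [integral, zero]

/-- The characteristic function of the difference of two elementary stochastic integrals. -/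
theorem charFun_integral_sub_integral [MeasurableSpace E] [BorelSpace E]
    [SecondCountableTopology E] [CompleteSpace E] {P : Measure Ω} [IsProbabilityMeasure P]
    {Z : ℝ → Ω → E} {η : E → ℂ} (hZ : IsTwoSidedLevyProcess Z P) (hη : IsLevyExponent Z P η)
    (G H : OperatorStep E s t) (a : E) :
    charFun (P.map fun ω => G.integral Z ω - H.integral Z ω) a =
      Complex.exp (-∫ r in s..t, η ((G.toFun r - H.toFun r).adjoint a)) := by
  classical
  obtain ⟨q, m, hq, hS⟩ := Finset.exists_monotone_nodes
    -- Time 0 is added as a node, so that no increment straddles the boundary between the two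
    -- independent halves of Z.
    (insert 0 ((Finset.range (G.n + 1)).image G.node ∪ (Finset.range (H.n + 1)).image H.node))
    (Finset.insert_nonempty _ _)
  have hG : G.IsRefinedBy q m := fun i hi => hS _ <| Finset.mem_insert_of_mem <|
    Finset.mem_union_left _ <| Finset.mem_image_of_mem _ <| Finset.mem_range.2 (by omega)
  have hH : H.IsRefinedBy q m := fun i hi => hS _ <| Finset.mem_insert_of_mem <|
    Finset.mem_union_right _ <| Finset.mem_image_of_mem _ <| Finset.mem_range.2 (by omega)
  obtain ⟨j, hjm, hj⟩ := hS 0 (Finset.mem_insert_self _ _)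
  have hsum : (fun ω => G.integral Z ω - H.integral Z ω) = fun ω => ∑ k ∈ Finset.range m,
      (G.toFun (q (k + 1)) - H.toFun (q (k + 1))) (Z (q (k + 1)) ω - Z (q k) ω) := by
    funext ω
    rw [integral_eq_sum_of_isRefinedBy hG hq, integral_eq_sum_of_isRefinedBy hH hq,
      ← Finset.sum_sub_distrib]
    rfl
  rw [hsum, hZ.charFun_sum_increments hη hq hjm hj
    (fun k => G.toFun (q (k + 1)) - H.toFun (q (k + 1))) a]
  congr 2
  set f : ℝ → ℂ := fun r => η ((G.toFun r - H.toFun r).adjoint a) with hf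
  have hconst : ∀ k, EqOn f (fun _ => f (q (k + 1))) (Ioc (q k) (q (k + 1))) := fun k r hr => by
    simp only [hf, toFun_eq_of_mem_Ioc hG hq hr, toFun_eq_of_mem_Ioc hH hq hr]
  have hint : ∀ k < m, IntervalIntegrable f volume (q k) (q (k + 1)) := fun k _ => by
    refine (intervalIntegrable_const (c := f (q (k + 1)))).congr ?_
    rw [uIoc_of_le (hq k.le_succ)]
    exact (hconst k).symm
  have hpiece : ∀ k, ∫ r in (q k)..(q (k + 1)), f r = ((q (k + 1) - q k : ℝ) : ℂ) * f (q (k + 1)) :=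
    fun k => by
      rw [intervalIntegral.integral_of_le (hq k.le_succ),
        setIntegral_congr_fun measurableSet_Ioc (hconst k),
        ← intervalIntegral.integral_of_le (hq k.le_succ), intervalIntegral.integral_const,
        Complex.real_smul]
  have hleft : q 0 ≤ s := by
    obtain ⟨k, -, hk⟩ := hG 0 (Nat.zero_le _)
    rw [← G.node_zero, ← hk]
    exact hq (Nat.zero_le k)
  have hright : t ≤ q m := by
    obtain ⟨k, hkm, hk⟩ := hG G.n le_rfl
    rw [← G.node_last, ← hk]
    exact hq hkm
  -- Because of the node 0, the refinement may leave [s, t]; outside (s, t] both step functions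
  -- vanish and η(0) = 0.
  have htot : ∫ r in s..t, f r = ∫ r in (q 0)..(q m), f r := by
    rw [intervalIntegral.integral_of_le G.le,
      intervalIntegral.integral_of_le (hleft.trans (G.le.trans hright))]
    refine (setIntegral_eq_of_subset_of_forall_sdiff_eq_zero measurableSet_Ioc
      (Ioc_subset_Ioc hleft hright) fun r hr => ?_).symm
    simp only [hf, toFun_eq_zero_of_notMem _ hr.2, sub_self, map_zero]
    simpa using hη.map_zero hZ.measurable
  rw [htot, ← intervalIntegral.sum_integral_adjacent_intervals hint]
  exact Finset.sum_congr rfl fun k _ => (hpiece k).symm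

/-- The characteristic function of an elementary stochastic integral. -/
theorem charFun_integral [MeasurableSpace E] [BorelSpace E]
    [SecondCountableTopology E] [CompleteSpace E] {P : Measure Ω} [IsProbabilityMeasure P]
    {Z : ℝ → Ω → E} {η : E → ℂ} (hZ : IsTwoSidedLevyProcess Z P) (hη : IsLevyExponent Z P η)
    (G : OperatorStep E s t) (a : E) :
    charFun (P.map (G.integral Z)) a =
      Complex.exp (-∫ r in s..t, η ((G.toFun r).adjoint a)) := by
  simpa using charFun_integral_sub_integral hZ hη G (zero E G.le) a

end OperatorStep

/-! ### Continuity of the evolution operator in its initial time -/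

namespace IsEvolutionOperator

variable {E : Type*} [NormedAddCommGroup E] [InnerProductSpace ℝ E]
  {A : ℝ → E →L[ℝ] E} {U : ℝ → ℝ → E →L[ℝ] E}

theorem hasDerivWithinAt_Ici (hU : IsEvolutionOperator A U) {s t : ℝ} (hst : s ≤ t) :
    HasDerivWithinAt (fun τ => U τ s) (A t ∘L U t s) (Ici t) t :=
  ((hU s).2 t hst).mono (Ici_subset_Ici.2 hst)

theorem continuousOn_left (hU : IsEvolutionOperator A U) (s t : ℝ) :
    ContinuousOn (fun τ => U τ s) (Icc s t) := fun τ hτ =>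
  ((hU s).2 τ hτ.1).continuousWithinAt.mono Icc_subset_Ici_self

theorem norm_le (hU : IsEvolutionOperator A U) {s t M : ℝ} (hM : ∀ τ ∈ Icc s t, ‖A τ‖ ≤ M) {τ : ℝ}
    (hτ : τ ∈ Icc s t) : ‖U τ s‖ ≤ Real.exp (M * (τ - s)) := by
  have h := norm_le_gronwallBound_of_norm_deriv_right_le (δ := 1) (K := M) (ε := 0)
    (hU.continuousOn_left s t) (fun x hx => hU.hasDerivWithinAt_Ici hx.1)
    (by rw [(hU s).1]; exact ContinuousLinearMap.norm_id_le)
    (fun x hx => by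
      rw [add_zero]
      exact (ContinuousLinearMap.opNorm_comp_le _ _).trans
        (mul_le_mul_of_nonneg_right (hM x ⟨hx.1, hx.2.le⟩) (norm_nonneg _))) τ hτ
  rwa [gronwallBound_ε0, one_mul] at h

/-- As functions of the final time, both sides solve the same linear equation with the same value at
s; Grönwall's inequality makes their difference vanish. -/
theorem eq_comp (hA : Continuous A) (hU : IsEvolutionOperator A U) {r s t : ℝ} (hrs : r ≤ s)
    (hst : s ≤ t) : U t r = U t s ∘L U s r := by
  obtain ⟨M, hM⟩ := isCompact_Icc.exists_bound_of_continuousOn (s := Icc s t) hA.continuousOn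
  have hc : ContinuousOn (fun τ => U τ r - U τ s ∘L U s r) (Icc s t) :=
    ((hU.continuousOn_left r t).mono (Icc_subset_Icc_left hrs)).sub
      ((hU.continuousOn_left s t).clm_comp continuousOn_const)
  have hd : ∀ τ ∈ Ico s t, HasDerivWithinAt (fun τ => U τ r - U τ s ∘L U s r)
      (A τ ∘L (U τ r - U τ s ∘L U s r)) (Ici τ) τ := by
    intro τ hτ
    have h1 := (hU.hasDerivWithinAt_Ici hτ.1).clm_comp (hasDerivWithinAt_const τ (Ici τ) (U s r))
    have h2 := (hU.hasDerivWithinAt_Ici (hrs.trans hτ.1)).fun_sub h1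
    convert! h2 using 1
    simp [ContinuousLinearMap.comp_sub, ContinuousLinearMap.comp_assoc]
  have h := eq_zero_of_abs_deriv_le_mul_abs_self_of_eq_zero_right (K := M) hc hd
    (by rw [(hU s).1]; simp)
    (fun τ hτ => (ContinuousLinearMap.opNorm_comp_le _ _).trans
        (mul_le_mul_of_nonneg_right (hM τ ⟨hτ.1, hτ.2.le⟩) (norm_nonneg _))) t ⟨hst, le_rfl⟩
  exact sub_eq_zero.1 h

/-- The evolution operator `U(t, r)` is continuous in the initial time `r`. -/
theorem continuousOn_right (hA : Continuous A) (hU : IsEvolutionOperator A U) (s t : ℝ) :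
    ContinuousOn (fun r => U t r) (Icc s t) := by
  obtain ⟨M, hM⟩ := isCompact_Icc.exists_bound_of_continuousOn (s := Icc s t) hA.continuousOn
  -- The maximum with 0 covers an empty interval, where M could be negative.
  have hM' : ∀ τ ∈ Icc s t, ‖A τ‖ ≤ max M 0 := fun τ hτ => (hM τ hτ).trans (le_max_left _ _)
  set K := max M 0
  have hK : 0 ≤ K := le_max_right _ _
  set C := Real.exp (K * (t - s))
  have hC : 0 ≤ C := (Real.exp_pos _).le
  have hbound : ∀ r ∈ Icc s t, ∀ τ ∈ Icc r t, ‖U τ r‖ ≤ C := fun r hr τ hτ =>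
    (hU.norm_le (fun x hx => hM' x ⟨hr.1.trans hx.1, hx.2⟩) hτ).trans <| by
      have h1 := hr.1
      have h2 := hτ.2
      refine Real.exp_le_exp.2 (mul_le_mul_of_nonneg_left (by linarith) hK)
  -- By the cocycle identity U(t,r) - U(t,r') = U(t,r')(U(r',r) - I). The first factor is at most C,
  -- and the second is at most KC(r' - r) because ∂U = AU.
  have hlip : ∀ r ∈ Icc s t, ∀ r' ∈ Icc s t, r ≤ r' → ‖U t r - U t r'‖ ≤ C * (K * C) * (r' - r) := by
    intro r hr r' hr' hrr
    have h1 : ‖U r' r - U r r‖ ≤ (K * C) * (r' - r) :=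
      norm_image_sub_le_of_norm_deriv_right_le_segment (f := fun τ => U τ r)
        (hU.continuousOn_left r r')
        (fun x hx => hU.hasDerivWithinAt_Ici hx.1)
        (fun x hx => (ContinuousLinearMap.opNorm_comp_le _ _).trans
          (mul_le_mul (hM' x ⟨hr.1.trans hx.1, hx.2.le.trans hr'.2⟩)
            (hbound r hr x ⟨hx.1, hx.2.le.trans hr'.2⟩) (norm_nonneg _) hK)) r' ⟨hrr, le_rfl⟩
    have h2 : U t r - U t r' = U t r' ∘L (U r' r - U r r) := by
      rw [eq_comp hA hU hrr hr'.2, (hU r).1, ContinuousLinearMap.comp_sub,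
        ContinuousLinearMap.comp_id]
    rw [h2, mul_assoc]
    exact (ContinuousLinearMap.opNorm_comp_le _ _).trans
      (mul_le_mul (hbound r' hr' t ⟨hr'.2, le_rfl⟩) h1 (norm_nonneg _) hC)
  refine (LipschitzOnWith.of_dist_le_mul (K := NNReal.mk (C * (K * C)) (by positivity))
    fun r hr r' hr' => ?_).continuousOn
  rw [NNReal.coe_mk, dist_eq_norm, Real.dist_eq]
  rcases le_total r r' with h | h
  · rw [abs_sub_comm, abs_of_nonneg (sub_nonneg.2 h)]
    exact hlip r hr r' hr' h
  · rw [norm_sub_rev, abs_of_nonneg (sub_nonneg.2 h)]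
    exact hlip r' hr' r hr h

end IsEvolutionOperator

/-! ### Uniform approximation by step functions -/

section Approximation

variable {E : Type*} [NormedAddCommGroup E] [InnerProductSpace ℝ E]

/-- The step function that samples `F` at the right end points of a uniform partition of
`(s, t]` into `k + 1` pieces. -/
noncomputable def OperatorStep.sample {s t : ℝ} (hst : s ≤ t) (F : ℝ → E →L[ℝ] E) (k : ℕ) :
    OperatorStep E s t where
  n := k + 1
  node i := s + (min i (k + 1) : ℕ) * ((t - s) / (k + 1))
  node_mono := fun i j hij => by
    have h : 0 ≤ (t - s) / (k + 1) := div_nonneg (sub_nonneg.2 hst) (by positivity)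
    dsimp only
    gcongr
  node_zero := by simp
  node_last := by
    rw [min_self, Nat.cast_add_one, mul_div_cancel₀ _ (by positivity)]
    ring
  val i := F (s + ((i + 1 : ℕ) : ℝ) * ((t - s) / (k + 1)))

/-- A continuous function is a uniform limit of step functions. -/
theorem OperatorStep.tendstoUniformlyOn_sample {s t : ℝ} (hst : s ≤ t) {F : ℝ → E →L[ℝ] E}
    (hF : ContinuousOn F (Icc s t)) :
    TendstoUniformlyOn (fun k => (OperatorStep.sample hst F k).toFun) F atTop (Ioc s t) := by
  rw [Metric.tendstoUniformlyOn_iff]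
  intro ε hε
  obtain ⟨δ, hδ, hF⟩ := Metric.uniformContinuousOn_iff.1
    (isCompact_Icc.uniformContinuousOn_of_continuous hF) ε hε
  have hlim : Tendsto (fun k : ℕ => (t - s) / ((k : ℝ) + 1)) atTop (𝓝 0) :=
    tendsto_const_nhds.div_atTop (tendsto_atTop_add_const_right _ _ tendsto_natCast_atTop_atTop)
  filter_upwards [hlim.eventually_lt_const hδ] with k hk r hr
  obtain ⟨i, hi, hri⟩ := (OperatorStep.sample hst F k).exists_mem_Ioc hr
  rw [OperatorStep.toFun_eq_val _ hi hri]
  have hi' : i < k + 1 := hi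
  have hle := (OperatorStep.sample hst F k).node_mono (Nat.succ_le_of_lt hi)
  rw [(OperatorStep.sample hst F k).node_last] at hle
  simp only [OperatorStep.sample, min_eq_left hi'.le, min_eq_left (Nat.succ_le_of_lt hi')]
    at hri hle ⊢
  refine hF r ⟨hr.1.le, hr.2⟩ _ ⟨hr.1.le.trans hri.2, hle⟩ ?_
  rw [dist_comm, Real.dist_eq, abs_of_nonneg (sub_nonneg.2 hri.2)]
  have h1 := hri.1
  push_cast
  linarith

end Approximation

/-! ### Existence and characteristic function of the stochastic integral -/

section StochasticIntegral

variable {Ω E : Type*} [MeasurableSpace Ω] {P : Measure Ω} [IsProbabilityMeasure P]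
  [NormedAddCommGroup E] [InnerProductSpace ℝ E] [FiniteDimensional ℝ E] [CompleteSpace E]

/-- Dominated convergence: once D i is within 1 of F, all arguments of η lie in the ball of radius
(M + 1)‖a‖, which is compact, so η is bounded there. -/
theorem tendsto_integral_comp_adjoint {ι : Type*} {l : Filter ι}
    [l.IsCountablyGenerated] {η : E → ℂ} (hη : Continuous η) {s t : ℝ} (hst : s ≤ t)
    {D : ι → ℝ → E →L[ℝ] E} {F : ℝ → E →L[ℝ] E} (hD : ∀ i, StronglyMeasurable (D i))
    (hDF : TendstoUniformlyOn D F l (Ioc s t)) {M : ℝ} (hM : ∀ r ∈ Ioc s t, ‖F r‖ ≤ M) (a : E) :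
    Tendsto (fun i => ∫ r in s..t, η ((D i r).adjoint a)) l
      (𝓝 (∫ r in s..t, η ((F r).adjoint a))) := by
  have := FiniteDimensional.proper_real E
  have hcont : Continuous fun L : E →L[ℝ] E => η (L.adjoint a) := by
    refine hη.comp ?_
    exact (ContinuousLinearMap.apply ℝ E a).continuous.comp
      (ContinuousLinearMap.adjoint (𝕜 := ℝ) (E := E) (F := E)).continuous
  obtain ⟨C, hC⟩ := (isCompact_closedBall (0 : E) ((M + 1) * ‖a‖)).exists_bound_of_continuousOn
    hη.continuousOn
  refine intervalIntegral.tendsto_integral_filter_of_dominated_convergence (fun _ => C)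
    (Eventually.of_forall fun i => (hcont.comp_stronglyMeasurable (hD i)).aestronglyMeasurable)
    ?_ intervalIntegrable_const (ae_of_all _ fun r hr => ?_)
  · filter_upwards [Metric.tendstoUniformlyOn_iff.1 hDF 1 one_pos] with i hi
    refine ae_of_all _ fun r hr => hC _ ?_
    rw [uIoc_of_le hst] at hr
    rw [mem_closedBall_zero_iff]
    refine (ContinuousLinearMap.le_opNorm _ _).trans
      (mul_le_mul_of_nonneg_right ?_ (norm_nonneg _))
    rw [LinearIsometryEquiv.norm_map]
    have h1 := hi r hr
    rw [dist_eq_norm, norm_sub_rev] at h1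
    have h2 : ‖D i r‖ ≤ ‖D i r - F r‖ + ‖F r‖ := norm_le_norm_sub_add _ _
    linarith [hM r hr]
  · rw [uIoc_of_le hst] at hr
    exact (hcont.tendsto _).comp (hDF.tendsto_at hr)

variable [MeasurableSpace E] [BorelSpace E] {Z : ℝ → Ω → E} {η : E → ℂ}

/-- Elementary integrals of step functions with the same uniform limit approach each other in
probability. -/
theorem IsTwoSidedLevyProcess.tendstoInMeasure_integral_sub (hZ : IsTwoSidedLevyProcess Z P)
    {ι : Type*} {l : Filter ι} [l.IsCountablyGenerated] {s t : ℝ}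
    {G H : ι → OperatorStep E s t} {F : ℝ → E →L[ℝ] E} (hst : s ≤ t)
    (hG : TendstoUniformlyOn (fun k => (G k).toFun) F l (Ioc s t))
    (hH : TendstoUniformlyOn (fun k => (H k).toFun) F l (Ioc s t)) :
    TendstoInMeasure P (fun k ω => (G k).integral Z ω - (H k).integral Z ω) l (fun _ => 0) := by
  have := FiniteDimensional.proper_real E
  obtain ⟨η, hη⟩ := hZ.levy.exists_exponent
  refine tendstoInMeasure_zero_of_tendsto_charFun (fun k =>
    (((G k).measurable_integral hZ.measurable).sub
      ((H k).measurable_integral hZ.measurable)).aemeasurable) fun a => ?_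
  simp only [OperatorStep.charFun_integral_sub_integral hZ hη]
  have hsub : TendstoUniformlyOn (fun k r => (G k).toFun r - (H k).toFun r) (fun _ => 0) l
      (Ioc s t) := by
    have := hG.sub hH
    rw [sub_self] at this
    exact this
  have hlim := tendsto_integral_comp_adjoint (hη.continuous hZ.measurable) hst
    (fun k => (G k).stronglyMeasurable_toFun.sub (H k).stronglyMeasurable_toFun) hsub (M := 0)
    (by simp) a
  have h0 : ∫ r in s..t, η ((0 : E →L[ℝ] E).adjoint a) = 0 := by
    simp [hη.map_zero hZ.measurable]
  rw [h0] at hlim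
  have := (Complex.continuous_exp.tendsto _).comp hlim.neg
  simpa [Function.comp_def] using this

/-- A continuous integrand is integrable with respect to a two-sided Lévy process. -/
theorem IsTwoSidedLevyProcess.exists_isStochIntegral (hZ : IsTwoSidedLevyProcess Z P)
    {s t : ℝ} (hst : s ≤ t) {F : ℝ → E →L[ℝ] E} (hF : ContinuousOn F (Icc s t)) :
    ∃ Y : Ω → E, IsStochIntegral P Z F s t Y := by
  have := FiniteDimensional.proper_real E
  let G := fun k => OperatorStep.sample hst F k
  have hG : TendstoUniformlyOn (fun k => (G k).toFun) F atTop (Ioc s t) :=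
    OperatorStep.tendstoUniformlyOn_sample hst hF
  obtain ⟨Y, hYm, hY⟩ := exists_tendstoInMeasure_of_cauchy (X := fun k => (G k).integral Z)
    (P := P) (fun k => ((G k).measurable_integral hZ.measurable).aemeasurable) <| by
      have h1 : Tendsto Prod.fst (atTop : Filter (ℕ × ℕ)) atTop := by
        rw [← prod_atTop_atTop_eq]; exact tendsto_fst
      have h2 : Tendsto Prod.snd (atTop : Filter (ℕ × ℕ)) atTop := by
        rw [← prod_atTop_atTop_eq]; exact tendsto_snd
      -- The Cauchy property is the comparison of two approximating families, indexed by ℕ × ℕ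
      -- through its two projections.
      exact hZ.tendstoInMeasure_integral_sub (G := fun p : ℕ × ℕ => G p.1)
        (H := fun p : ℕ × ℕ => G p.2) hst (fun u hu => h1.eventually (hG u hu))
        (fun u hu => h2.eventually (hG u hu))
  exact ⟨Y, hYm, ⟨G, hG⟩, fun H hH =>
    hY.add_of_zero (hZ.tendstoInMeasure_integral_sub hst hH hG)⟩

/-- The characteristic function of a stochastic integral. -/
theorem IsStochIntegral.charFun_eq (hZ : IsTwoSidedLevyProcess Z P) (hη : IsLevyExponent Z P η)
    {s t : ℝ} (hst : s ≤ t) {F : ℝ → E →L[ℝ] E} (hF : ContinuousOn F (Icc s t)) {Y : Ω → E}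
    (hY : IsStochIntegral P Z F s t Y) (a : E) :
    charFun (P.map Y) a = Complex.exp (-∫ r in s..t, η ((F r).adjoint a)) := by
  have := FiniteDimensional.proper_real E
  obtain ⟨hYm, ⟨G, hG⟩, hlim⟩ := hY
  obtain ⟨M, hM⟩ := isCompact_Icc.exists_bound_of_continuousOn hF
  have h1 := (hlim G hG).tendsto_charFun
    (fun k => ((G k).measurable_integral hZ.measurable).aemeasurable) hYm a
  simp only [OperatorStep.charFun_integral hZ hη] at h1
  have h2 := tendsto_integral_comp_adjoint (hη.continuous hZ.measurable) hst
    (fun k => (G k).stronglyMeasurable_toFun) hG (fun r hr => hM r (Ioc_subset_Icc_self hr)) a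
  exact tendsto_nhds_unique h1 ((Complex.continuous_exp.tendsto _).comp h2.neg)

end StochasticIntegral

/-! ### The main theorem -/

theorem proposition2p4 {Ω : Type*} [MeasurableSpace Ω] (P : Measure Ω) [IsProbabilityMeasure P]
    (d : ℕ)
    (A B : ℝ → EuclideanSpace ℝ (Fin d) →L[ℝ] EuclideanSpace ℝ (Fin d))
    (hA : Continuous A) (hB : Continuous B)
    (U : ℝ → ℝ → EuclideanSpace ℝ (Fin d) →L[ℝ] EuclideanSpace ℝ (Fin d))
    (hU : IsEvolutionOperator A U)
    (Z : ℝ → Ω → EuclideanSpace ℝ (Fin d)) (hZ : IsTwoSidedLevyProcess Z P) :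
    (∃! η : EuclideanSpace ℝ (Fin d) → ℂ, IsLevyExponent Z P η) ∧
    ∀ η : EuclideanSpace ℝ (Fin d) → ℂ, IsLevyExponent Z P η →
      ∀ s t : ℝ, s ≤ t →
        (∃ Y : Ω → EuclideanSpace ℝ (Fin d),
          IsStochIntegral P Z (fun r => U t r ∘L B r) s t Y) ∧
        ∀ Y : Ω → EuclideanSpace ℝ (Fin d),
          IsStochIntegral P Z (fun r => U t r ∘L B r) s t Y →
          ∀ a : EuclideanSpace ℝ (Fin d),
            IntervalIntegrable
              (fun r => η ((B r).adjoint ((U t r).adjoint a))) volume s t ∧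
            charFun (P.map Y) a =
              Complex.exp (-∫ r in s..t, η ((B r).adjoint ((U t r).adjoint a))) := by
  obtain ⟨η₀, hη₀⟩ := hZ.levy.exists_exponent
  refine ⟨⟨η₀, hη₀, fun η hη => hη.unique hη₀⟩, fun η hη s t hst => ?_⟩
  have hF : ContinuousOn (fun r => U t r ∘L B r) (Icc s t) :=
    (hU.continuousOn_right hA s t).clm_comp hB.continuousOn
  refine ⟨hZ.exists_isStochIntegral hst hF, fun Y hY a => ⟨?_, ?_⟩⟩
  · have hadj : ContinuousOn (fun r => (U t r ∘L B r).adjoint a) (Icc s t) :=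
      ((ContinuousLinearMap.adjoint (𝕜 := ℝ)).continuous.comp_continuousOn hF).clm_apply
        continuousOn_const
    have h := (hη.continuous hZ.measurable).comp_continuousOn hadj
    rw [← uIcc_of_le hst] at h
    simpa [Function.comp_def, ContinuousLinearMap.adjoint_comp] using
      h.intervalIntegrable (μ := volume)
  · simpa [ContinuousLinearMap.adjoint_comp] using hY.charFun_eq hZ hη hst hF a
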